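/- Let $q$, $n$, $d$ be positive integers with $q\ge 2$ and $d\le n$. Let $A_q(n,d)$ denote the maximum number of words in a code of length $n$ and minimum Hamming distance at least $d$ over an alphabet with $q$ letters ($q$ need not be a prime power). For an integer $m\ge 0$ let $$V_q(n,m)=\sum_{i=0}^{m}\binom{n}{i}(q-1)^i$$ be the volume of a $q$-ary Hamming sphere of radius $m$, and let $$e_q(n,m)=\frac16\sum_{w=1}^{m}\sum_{i=1}^{m}\sum_{j=0}^{a}\sum_{k=b}^{a-j}\frac{n!\,(q-2)^k\,(q-1)^{w+i-c}}{j!\,k!\,(w-c)!\,(i-c)!\,(n+c-w-i)!}\;-\;\frac{V_q(n,m)}{6},$$ where $a=\min\{w,i\}$, $c=j+k$, $b$ is the smallest nonnegative integer that is at least $(w+i)-j-\min\{m+j,n\}$, and $0^0=1$. Suppose that $e_q(n,d-1)>0$, so that its logarithm is defined (this fails only if $d=1$ or $q=d=2$, where $e_q(n,d-1)=-\tfrac16$). Then $$A_q(n,d)\;\ge\;\frac{q^n}{V_q(n,d-1)}\cdot\frac{\log_2 V_q(n,d-1)-\log_2\sqrt{e_q(n,d-1)}}{10}.$$ -/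

import Mathlib

open Finset

/-- `IsCode q n d C`: the set `C` of words of length `n` over the `q`-letter alphabet `Fin q` is a
code of minimum distance at least `d`, that is, any two distinct words of `C` differ in at least
`d` positions. -/
def IsCode (q n d : ℕ) (C : Finset (Fin n → Fin q)) : Prop :=
  ∀ u ∈ C, ∀ v ∈ C, u ≠ v → d ≤ hammingDist u v

open Classical in
/-- `A_q(n, d)`: the maximum number of words in a `q`-ary code of length `n` and minimum
distance (at least) `d`. -/
noncomputable def maxCodeSize (q n d : ℕ) : ℕ :=
  ((univ : Finset (Finset (Fin n → Fin q))).filter (IsCode q n d)).sup Finset.card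

/-- `V_q(n, d) = ∑_{i=0}^{d} C(n, i) (q - 1)^i`, the volume of a `q`-ary Hamming sphere of
radius `d`. -/
def sphereVolume (q n d : ℕ) : ℝ :=
  ∑ i ∈ Icc 0 d, (n.choose i : ℝ) * ((q : ℝ) - 1) ^ i

/-- The lower limit `b` of the innermost sum: the smallest nonnegative integer that is at least
`(w + i) - j - min (d + j) n` (an integer that may be negative). -/
def lowerLimit (n d w i j : ℕ) : ℕ :=
  (((w : ℤ) + i) - j - min ((d : ℤ) + j) n).toNat

/-- The summand of the quadruple sum, with `c = j + k`. In the range of summation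
`c ≤ min w i` and `w + i ≤ n + c`, so that none of the natural-number subtractions truncates. -/
noncomputable def edgeTerm (q n w i j k : ℕ) : ℝ :=
  ((n.factorial : ℝ) * ((q : ℝ) - 2) ^ k * ((q : ℝ) - 1) ^ (w + i - (j + k))) /
    ((j.factorial : ℝ) * (k.factorial : ℝ) * ((w - (j + k)).factorial : ℝ) *
      ((i - (j + k)).factorial : ℝ) * ((n + (j + k) - w - i).factorial : ℝ))

/-- The quantity `e_q(n, d)`, with `a = min w i` and `b = lowerLimit n d w i j`. -/
noncomputable def edgeQuantity (q n d : ℕ) : ℝ :=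
  1 / 6 * (∑ w ∈ Icc 1 d, ∑ i ∈ Icc 1 d, ∑ j ∈ Icc 0 (min w i),
    ∑ k ∈ Icc (lowerLimit n d w i j) (min w i - j), edgeTerm q n w i j k)
  - sphereVolume q n d / 6

/-! Join distinct words at distance at most `d - 1`. Codes are the independent sets of this graph,
which is regular of degree `D = V - 1` and translation invariant. Each neighbourhood spans few
edges: `p = 6e + 1` counts the ordered adjacent pairs among the neighbours of the zero word.

Draw an independent set `I` from the hard-core model at fugacity `x`. If for every vertex `v` the
expectation of `D * 1[v ∈ I] + #(I ∩ N(v))` is at least `b`, then summing over `v` gives an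
independent set of size at least `b * q ^ n / (2 * D)` (`exists_indep_of_local_occupancy`). By
conditioning on `I` outside the closed neighbourhood of `v`, this reduces to an inequality for each
set `H` of available neighbours (`sum_local_occupancy`). There, either the partition function of `H`
is small, so `v` itself is likely to be occupied, or it is large, so `H` is large and, being sparse,
contains many occupied vertices (`local_occupancy`).

With `x` of order `1 / √p` and threshold `r = √(V / √e)`, one can take `b` proportional to `log r`
(`fugacity_estimates`). This needs `r` large; otherwise the Gilbert–Varshamov bound is already
stronger. -/

/-! ### The hard-core model: local estimates on a finite vertex set. -/

section HardCore

variable {α : Type*} [DecidableEq α] (G : SimpleGraph α) [DecidableRel G.Adj]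

/-- The independent sets of `G` contained in `H`. -/
def indepSubsets (H : Finset α) : Finset (Finset α) :=
  H.powerset.filter fun K => G.IsIndepSet (K : Set α)

/-- The partition function of the hard-core model on `H` at fugacity `x`. -/
def partitionFunction (x : ℝ) (H : Finset α) : ℝ :=
  ∑ K ∈ indepSubsets G H, x ^ #K

/-- The unnormalised expected size of an independent subset of `H` in the hard-core model. -/
def weightedSize (x : ℝ) (H : Finset α) : ℝ :=
  ∑ K ∈ indepSubsets G H, (#K : ℝ) * x ^ #K

variable {G}

theorem mem_indepSubsets {H K : Finset α} :
    K ∈ indepSubsets G H ↔ K ⊆ H ∧ ∀ u ∈ K, ∀ v ∈ K, ¬ G.Adj u v := by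
  simp only [indepSubsets, mem_filter, mem_powerset, SimpleGraph.isIndepSet_iff]
  refine and_congr_right fun _ => ⟨fun h u hu v hv huv => ?_, fun h u hu v hv _ => h u hu v hv⟩
  exact h hu hv huv.ne huv

/-- Erasing `u` is a bijection onto the independent sets to which `u` can be added, and it costs one
factor `x`. -/
theorem sum_indepSubsets_mem_eq {x : ℝ} {H : Finset α} {u : α} (hu : u ∈ H) :
    ∑ K ∈ indepSubsets G H with u ∈ K, x ^ #K =
      x * ∑ K ∈ indepSubsets G H with u ∉ K ∧ ∀ v ∈ K, ¬ G.Adj u v, x ^ #K := by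
  rw [mul_sum]
  refine sum_nbij' (fun K => K.erase u) (fun K => insert u K) ?_ ?_ ?_ ?_ ?_
  · intro K hK
    simp only [mem_filter, mem_indepSubsets] at hK ⊢
    refine ⟨⟨(erase_subset _ _).trans hK.1.1, fun a ha b hb => ?_⟩, by simp, fun v hv => ?_⟩
    · exact hK.1.2 a (mem_of_mem_erase ha) b (mem_of_mem_erase hb)
    · exact hK.1.2 u hK.2 v (mem_of_mem_erase hv)
  · intro K hK
    simp only [mem_filter, mem_indepSubsets] at hK ⊢
    refine ⟨⟨insert_subset hu hK.1.1, fun a ha b hb => ?_⟩, by simp⟩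
    rcases mem_insert.1 ha with rfl | ha' <;> rcases mem_insert.1 hb with rfl | hb'
    · exact G.irrefl
    · exact hK.2.2 b hb'
    · exact fun h => hK.2.2 a ha' h.symm
    · exact hK.1.2 a ha' b hb'
  · intro K hK
    exact insert_erase (mem_filter.1 hK).2
  · intro K hK
    exact erase_insert (mem_filter.1 hK).2.1
  · intro K hK
    rw [← pow_succ', card_erase_add_one (mem_filter.1 hK).2]

theorem sum_indepSubsets_mem_le {x : ℝ} (hx : 0 ≤ x) {H : Finset α} {u : α} (hu : u ∈ H) :
    ∑ K ∈ indepSubsets G H with u ∈ K, x ^ #K ≤ x * partitionFunction G x H := by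
  rw [sum_indepSubsets_mem_eq hu]
  refine mul_le_mul_of_nonneg_left ?_ hx
  exact sum_le_sum_of_subset_of_nonneg (filter_subset _ _) fun _ _ _ => by positivity

theorem weightedSize_eq_sum (x : ℝ) (H : Finset α) :
    weightedSize G x H = ∑ u ∈ H, ∑ K ∈ indepSubsets G H with u ∈ K, x ^ #K := by
  simp only [sum_filter]
  rw [sum_comm, weightedSize]
  refine sum_congr rfl fun K hK => ?_
  rw [← sum_filter, sum_const, nsmul_eq_mul, filter_mem_eq_inter,
    inter_eq_right.2 (mem_indepSubsets.1 hK).1]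

/-- Union bound: an independent set can receive `u`, already contains `u`, or contains a neighbour
of `u`. -/
theorem partitionFunction_le_add {x : ℝ} (hx : 0 ≤ x) (H : Finset α) (u : α) :
    partitionFunction G x H ≤
      ∑ K ∈ indepSubsets G H with u ∉ K ∧ ∀ v ∈ K, ¬ G.Adj u v, x ^ #K +
        ∑ K ∈ indepSubsets G H with u ∈ K, x ^ #K +
        ∑ v ∈ H with G.Adj u v, ∑ K ∈ indepSubsets G H with v ∈ K, x ^ #K := by
  simp only [sum_filter (s := indepSubsets G H)]
  rw [sum_comm (s := H.filter _), ← sum_add_distrib, ← sum_add_distrib, partitionFunction]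
  refine sum_le_sum fun K hK => ?_
  have h0 : 0 ≤ x ^ #K := by positivity
  have h1 : 0 ≤ ∑ v ∈ H with G.Adj u v, if v ∈ K then x ^ #K else 0 :=
    sum_nonneg fun _ _ => by split_ifs <;> simp [h0]
  by_cases huK : u ∈ K
  · simp only [huK, not_true_eq_false, false_and, if_false, if_true]
    linarith
  by_cases hN : ∀ v ∈ K, ¬ G.Adj u v
  · rw [if_pos ⟨huK, hN⟩, if_neg huK]
    linarith
  · rw [if_neg fun h => hN h.2, if_neg huK]
    push Not at hN
    obtain ⟨v, hv, huv⟩ := hN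
    have hvH : v ∈ H.filter (G.Adj u) := mem_filter.2 ⟨(mem_indepSubsets.1 hK).1 hv, huv⟩
    have := single_le_sum (f := fun v => if v ∈ K then x ^ #K else 0)
      (fun _ _ => by split_ifs <;> simp [h0]) hvH
    simp only [hv, if_true] at this
    linarith

/-- In a graph with few edges, the hard-core model has almost as many occupied vertices as it would
in a graph without edges. -/
theorem le_one_add_mul_weightedSize {x : ℝ} (hx : 0 ≤ x) (H : Finset α) :
    x * (#H - x * ∑ u ∈ H, #{v ∈ H | G.Adj u v}) * partitionFunction G x H ≤
      (1 + x) * weightedSize G x H := by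
  have key : ∀ u ∈ H, x * partitionFunction G x H -
      x ^ 2 * partitionFunction G x H * #{v ∈ H | G.Adj u v} ≤
      (1 + x) * ∑ K ∈ indepSubsets G H with u ∈ K, x ^ #K := by
    intro u hu
    -- After multiplication by `x`, the first term of the union bound becomes the weight of the sets
    -- containing `u`, whence the factor `1 + x`.
    have h1 := mul_le_mul_of_nonneg_left (partitionFunction_le_add (G := G) hx H u) hx
    rw [mul_add, mul_add, ← sum_indepSubsets_mem_eq hu] at h1
    have h2 : ∑ v ∈ H with G.Adj u v, ∑ K ∈ indepSubsets G H with v ∈ K, x ^ #K ≤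
        #{v ∈ H | G.Adj u v} * (x * partitionFunction G x H) := by
      rw [← nsmul_eq_mul]
      exact sum_le_card_nsmul _ _ _ fun v hv => sum_indepSubsets_mem_le hx (mem_filter.1 hv).1
    have h3 := mul_le_mul_of_nonneg_left h2 hx
    linarith
  have := sum_le_sum key
  rw [sum_sub_distrib, sum_const, ← mul_sum, ← mul_sum, ← weightedSize_eq_sum, nsmul_eq_mul] at this
  push_cast
  linarith

theorem partitionFunction_le_exp {x : ℝ} (hx : 0 ≤ x) (H : Finset α) :
    partitionFunction G x H ≤ Real.exp (x * #H) := by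
  calc partitionFunction G x H ≤ ∑ K ∈ H.powerset, x ^ #K :=
        sum_le_sum_of_subset_of_nonneg (filter_subset _ _) fun _ _ _ => by positivity
    _ = (1 + x) ^ #H := by
        have := Finset.sum_pow_mul_eq_add_pow x 1 H
        simp only [one_pow, mul_one] at this
        rw [this, add_comm]
    _ ≤ Real.exp x ^ #H := by
        gcongr
        linarith [Real.add_one_le_exp x]
    _ = _ := by rw [← Real.exp_nat_mul, mul_comm]

theorem partitionFunction_pos {x : ℝ} (hx : 0 ≤ x) (H : Finset α) :
    0 < partitionFunction G x H := by
  refine lt_of_lt_of_le one_pos ?_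
  have h : (∅ : Finset α) ∈ indepSubsets G H := mem_indepSubsets.2 (by simp)
  have := single_le_sum (f := fun K : Finset α => x ^ #K) (fun _ _ => by positivity) h
  simpa [partitionFunction] using this

theorem weightedSize_nonneg {x : ℝ} (hx : 0 ≤ x) (H : Finset α) : 0 ≤ weightedSize G x H :=
  sum_nonneg fun _ _ => by positivity

/-- If the degree `D` is large or the neighbourhood is likely to be well occupied, the local
occupancy around a vertex is at least `b`. -/
theorem local_occupancy {x b D M p : ℝ} (hx : 0 < x) (hb : 0 ≤ b) (hM : 1 ≤ M) (H : Finset α)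
    (hp : (∑ u ∈ H, #{v ∈ H | G.Adj u v} : ℕ) ≤ p)
    (h1 : b * (x + M) ≤ D * x) (h2 : b * (1 + x) ≤ Real.log M - x ^ 2 * p) :
    b * (x + partitionFunction G x H) ≤ D * x + weightedSize G x H := by
  have hZ := partitionFunction_pos (G := G) hx.le H
  rcases le_total (partitionFunction G x H) M with h | h
  · have := weightedSize_nonneg (G := G) hx.le H
    nlinarith
  · have hcard : Real.log M ≤ x * #H := by
      rw [← Real.log_exp (x * #H)]
      exact Real.log_le_log (by linarith) (h.trans (partitionFunction_le_exp hx.le H))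
    have h3 := le_one_add_mul_weightedSize (G := G) hx.le H
    have h4 : b * (1 + x) ≤ x * (#H - x * (∑ u ∈ H, #{v ∈ H | G.Adj u v} : ℕ)) := by
      have := mul_le_mul_of_nonneg_left hp (sq_nonneg x)
      nlinarith
    have h5 : (1 + x) * (b * partitionFunction G x H) ≤ (1 + x) * weightedSize G x H := by
      have := mul_le_mul_of_nonneg_right h4 hZ.le
      linarith
    have h6 := le_of_mul_le_mul_left h5 (by linarith)
    nlinarith

/-! ### From local occupancy to a large independent set. -/

variable [Fintype α]

/-- Spatial Markov property: once the trace `J` outside the closed neighbourhood of `v` is fixed,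
either `v` is occupied and excludes all its neighbours, or the rest is any independent set of
neighbours not blocked by `J`. -/
theorem sum_fiber_eq (v : α) {J : Finset α} (hJ : J ∈ indepSubsets G univ)
    (hJv : Disjoint J (insert v (G.neighborFinset v))) (f : Finset α → ℝ) :
    ∑ I ∈ indepSubsets G univ with I \ insert v (G.neighborFinset v) = J, f I =
      f (insert v J) +
        ∑ K ∈ indepSubsets G {u ∈ G.neighborFinset v | ∀ w ∈ J, ¬ G.Adj u w}, f (J ∪ K) := by
  set N := G.neighborFinset v with hN
  have hvJ : v ∉ J := fun h => disjoint_left.1 hJv h (mem_insert_self _ _)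
  have hNJ : ∀ w ∈ J, ¬ G.Adj v w := fun w hw h =>
    disjoint_left.1 hJv hw (mem_insert_of_mem (by simpa [hN] using h))
  have hvN : v ∉ N := by simp [hN]
  have hmemJ := (mem_indepSubsets.1 hJ).2
  rw [← sum_filter_add_sum_filter_not _ (fun I => v ∈ I), filter_filter, filter_filter]
  congr 1
  · have : (indepSubsets G univ).filter (fun I => I \ insert v N = J ∧ v ∈ I) = {insert v J} := by
      ext I
      simp only [mem_filter, mem_singleton]
      constructor
      · rintro ⟨hI, rfl, hv⟩
        ext u
        simp only [mem_insert, mem_sdiff]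
        constructor
        · intro hu
          by_cases huv : u = v
          · exact Or.inl huv
          · refine Or.inr ⟨hu, ?_⟩
            rintro (h | h)
            · exact huv h
            · exact (mem_indepSubsets.1 hI).2 v hv u hu (by simpa [hN] using h)
        · rintro (rfl | h)
          · exact hv
          · exact h.1
      · rintro rfl
        refine ⟨mem_indepSubsets.2 ⟨subset_univ _, fun a ha b hb => ?_⟩, ?_, mem_insert_self _ _⟩
        · rcases mem_insert.1 ha with rfl | ha' <;> rcases mem_insert.1 hb with rfl | hb'
          · exact G.irrefl
          · exact hNJ b hb'
          · exact fun h => hNJ a ha' h.symm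
          · exact hmemJ a ha' b hb'
        · ext u
          have h1 : u ∈ J → u ∉ insert v N := fun h => disjoint_left.1 hJv h
          simp only [mem_insert, mem_sdiff] at h1 ⊢
          tauto
    rw [this, sum_singleton]
  · symm
    refine sum_nbij' (fun K => J ∪ K) (fun I => I ∩ N) ?_ ?_ ?_ ?_ ?_
    · intro K hK
      have hK' := mem_indepSubsets.1 hK
      have hKN : ∀ u ∈ K, u ∈ N := fun u hu => (mem_filter.1 (hK'.1 hu)).1
      have hKJ : ∀ u ∈ K, ∀ w ∈ J, ¬ G.Adj u w := fun u hu => (mem_filter.1 (hK'.1 hu)).2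
      simp only [mem_filter]
      refine ⟨mem_indepSubsets.2 ⟨subset_univ _, fun a ha b hb => ?_⟩, ?_, ?_⟩
      · rcases mem_union.1 ha with ha | ha <;> rcases mem_union.1 hb with hb | hb
        · exact hmemJ a ha b hb
        · exact fun h => hKJ b hb a ha h.symm
        · exact hKJ a ha b hb
        · exact hK'.2 a ha b hb
      · ext u
        have h1 : u ∈ J → u ∉ insert v N := fun h => disjoint_left.1 hJv h
        have h2 := hKN u
        simp only [mem_insert, mem_sdiff, mem_union] at h1 ⊢
        tauto
      · rw [mem_union]
        rintro (h | h)
        · exact hvJ h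
        · exact hvN (hKN v h)
    · intro I hI
      simp only [mem_filter] at hI
      obtain ⟨hI, rfl, hv⟩ := hI
      have hI' := (mem_indepSubsets.1 hI).2
      refine mem_indepSubsets.2 ⟨fun u hu => mem_filter.2 ⟨(mem_inter.1 hu).2, fun w hw => ?_⟩, ?_⟩
      · exact hI' u (mem_inter.1 hu).1 w (mem_sdiff.1 hw).1
      · exact fun a ha b hb => hI' a (mem_inter.1 ha).1 b (mem_inter.1 hb).1
    · intro K hK
      have hK' := mem_indepSubsets.1 hK
      ext u
      have h1 : u ∈ J → u ∉ insert v N := fun h => disjoint_left.1 hJv h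
      have h2 : u ∈ K → u ∈ N := fun hu => (mem_filter.1 (hK'.1 hu)).1
      simp only [mem_insert, mem_inter, mem_union] at h1 ⊢
      tauto
    · intro I hI
      simp only [mem_filter] at hI
      obtain ⟨hI, rfl, hv⟩ := hI
      ext u
      have : u ∈ I → u ≠ v := fun h h' => hv (h' ▸ h)
      simp only [mem_insert, mem_inter, mem_union, mem_sdiff]
      tauto
    · intro K _
      rfl

/-- On each fibre the common factor `x ^ #J` splits off, leaving the hypothesis for the set `H` of
unblocked neighbours. -/
theorem sum_local_occupancy {x b : ℝ} {D : ℕ} (hx : 0 ≤ x) (v : α)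
    (hloc : ∀ H ⊆ G.neighborFinset v,
      b * (x + partitionFunction G x H) ≤ D * x + weightedSize G x H) :
    b * partitionFunction G x univ ≤
      ∑ I ∈ indepSubsets G univ,
        (D * (if v ∈ I then 1 else 0) + #(I ∩ G.neighborFinset v) : ℝ) * x ^ #I := by
  set N := G.neighborFinset v with hN
  have hmaps : ∀ I ∈ indepSubsets G (univ : Finset α), I \ insert v N ∈
      {J ∈ indepSubsets G (univ : Finset α) | Disjoint J (insert v N)} := by
    intro I hI
    refine mem_filter.2 ⟨mem_indepSubsets.2 ⟨subset_univ _, fun a ha b hb => ?_⟩, sdiff_disjoint⟩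
    exact (mem_indepSubsets.1 hI).2 a (mem_sdiff.1 ha).1 b (mem_sdiff.1 hb).1
  rw [partitionFunction, ← sum_fiberwise_of_maps_to hmaps, ← sum_fiberwise_of_maps_to hmaps,
    mul_sum]
  refine sum_le_sum fun J hJ => ?_
  obtain ⟨hJ, hJv⟩ := mem_filter.1 hJ
  rw [sum_fiber_eq v hJ hJv, sum_fiber_eq v hJ hJv]
  have hvJ : v ∉ J := fun h => disjoint_left.1 hJv h (mem_insert_self _ _)
  have hvN : v ∉ N := by simp [hN]
  have hJN : J ∩ N = ∅ :=
    disjoint_iff_inter_eq_empty.1 (hJv.mono_right (subset_insert _ _))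
  set H := {u ∈ N | ∀ w ∈ J, ¬ G.Adj u w} with hH
  have hHN : H ⊆ N := filter_subset _ _
  have hKd : ∀ K ∈ indepSubsets G H, Disjoint J K := fun K hK =>
    (hJv.mono_right (subset_insert _ _)).mono_right ((mem_indepSubsets.1 hK).1.trans hHN)
  have e1 : ∑ K ∈ indepSubsets G H, x ^ #(J ∪ K) = x ^ #J * partitionFunction G x H := by
    rw [partitionFunction, mul_sum]
    refine sum_congr rfl fun K hK => ?_
    rw [card_union_of_disjoint (hKd K hK), pow_add]
  have e2 : ∑ K ∈ indepSubsets G H,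
      (D * (if v ∈ J ∪ K then 1 else 0) + #((J ∪ K) ∩ N) : ℝ) * x ^ #(J ∪ K) =
      x ^ #J * weightedSize G x H := by
    rw [weightedSize, mul_sum]
    refine sum_congr rfl fun K hK => ?_
    have hKN := (mem_indepSubsets.1 hK).1.trans hHN
    have : v ∉ J ∪ K := by
      rw [mem_union]
      rintro (h | h)
      · exact hvJ h
      · exact hvN (hKN h)
    rw [card_union_of_disjoint (hKd K hK), pow_add, if_neg this, union_inter_distrib_right, hJN,
      empty_union, inter_eq_left.2 hKN]
    ring
  rw [e1, e2, if_pos (mem_insert_self _ _), insert_inter_of_notMem hvN, hJN,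
    card_insert_of_notMem hvJ, card_empty]
  have := mul_le_mul_of_nonneg_left (hloc H hHN) (pow_nonneg hx #J)
  push_cast
  rw [pow_succ]
  linarith

/-- A regular graph whose local occupancy is at least `b` has an independent set of at least
`b |V| / (2 D)` vertices. -/
theorem exists_indep_of_local_occupancy {x b : ℝ} {D : ℕ} (hx : 0 < x)
    (hreg : G.IsRegularOfDegree D)
    (hloc : ∀ v, ∀ H ⊆ G.neighborFinset v,
      b * (x + partitionFunction G x H) ≤ D * x + weightedSize G x H) :
    ∃ I : Finset α, (∀ u ∈ I, ∀ v ∈ I, ¬ G.Adj u v) ∧ b * Fintype.card α ≤ 2 * D * #I := by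
  have h := sum_le_sum fun v (_ : v ∈ (univ : Finset α)) => sum_local_occupancy hx.le v (hloc v)
  rw [sum_const, card_univ, nsmul_eq_mul, sum_comm, partitionFunction, mul_sum, mul_sum] at h
  obtain ⟨I, hI, hle⟩ := exists_le_of_sum_le ⟨∅, mem_indepSubsets.2 (by simp)⟩ h
  refine ⟨I, (mem_indepSubsets.1 hI).2, ?_⟩
  rw [← sum_mul] at hle
  -- Each vertex of `I` is counted `D` times by its own indicator and once by each of its `D`
  -- neighbours.
  have hsum : ∑ v, (D * (if v ∈ I then 1 else 0) + #(I ∩ G.neighborFinset v) : ℝ) =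
      2 * D * #I := by
    rw [sum_add_distrib, ← mul_sum, sum_boole, filter_univ_mem]
    have : ∑ v, #(I ∩ G.neighborFinset v) = #I * D := by
      have h1 : ∀ v, #(I ∩ G.neighborFinset v) = ∑ u ∈ I, if G.Adj v u then 1 else 0 := by
        intro v
        rw [← card_filter]
        congr 1
        ext u
        simp
      simp only [h1]
      rw [sum_comm, sum_const_nat]
      intro u _
      rw [← card_filter, ← hreg u, ← SimpleGraph.card_neighborFinset_eq_degree]
      congr 1
      ext w
      simp [G.adj_comm]
    have h' : ∑ v, (#(I ∩ G.neighborFinset v) : ℝ) = #I * D := by exact_mod_cast this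
    rw [h']
    ring
  rw [hsum] at hle
  refine le_of_mul_le_mul_right (a := x ^ #I) ?_ (by positivity)
  linarith

end HardCore

/-! ### Counting words and pairs of words by their letter patterns. -/

section Counting

/-- The number of functions that take values in each class a prescribed number of times. -/
theorem card_filter_class_eq {α κ : Type*} [Fintype α] [DecidableEq α] [Fintype κ] [DecidableEq κ]
    (cls : α → κ) (n : ℕ) (t : κ → ℕ) (ht : ∑ c, t c = n)
    [DecidablePred fun g : Fin n → α => ∀ c, #{i | cls (g i) = c} = t c] :
    #{g : Fin n → α | ∀ c, #{i | cls (g i) = c} = t c} =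
      Nat.multinomial univ t * ∏ c, #{a | cls a = c} ^ t c := by
  classical
  -- Generating function with one variable per class; the count is the coefficient of the monomial
  -- with exponent `t`.
  have h1 : ∑ g : Fin n → α, ∏ i, (MvPolynomial.X (cls (g i)) : MvPolynomial κ ℕ) =
      (∑ c, (#{a | cls a = c} : MvPolynomial κ ℕ) * MvPolynomial.X c) ^ n := by
    have h2 : ∑ c, (#{a | cls a = c} : MvPolynomial κ ℕ) * MvPolynomial.X c =
        ∑ a, MvPolynomial.X (cls a) := by
      rw [← sum_fiberwise univ cls]
      refine sum_congr rfl fun c _ => ?_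
      rw [← nsmul_eq_mul, ← sum_const]
      exact sum_congr rfl fun a ha => by rw [(mem_filter.1 ha).2]
    rw [h2, ← Fin.prod_const n, prod_univ_sum, Fintype.piFinset_univ]
  have h3 := congrArg (MvPolynomial.coeff (Finsupp.equivFunOnFinite.symm t)) h1
  rw [sum_pow_eq_sum_piAntidiag, MvPolynomial.coeff_sum, MvPolynomial.coeff_sum] at h3
  have hL : ∀ g : Fin n → α, MvPolynomial.coeff (Finsupp.equivFunOnFinite.symm t)
      (∏ i, (MvPolynomial.X (cls (g i)) : MvPolynomial κ ℕ)) =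
      if ∀ c, #{i | cls (g i) = c} = t c then 1 else 0 := by
    intro g
    have : (∏ i, (MvPolynomial.X (cls (g i)) : MvPolynomial κ ℕ)) =
        MvPolynomial.monomial (∑ i, Finsupp.single (cls (g i)) 1) 1 := by
      rw [MvPolynomial.monomial_sum_one]
      rfl
    rw [this, MvPolynomial.coeff_monomial]
    congr 1
    rw [Finsupp.ext_iff]
    simp [Finsupp.finsetSum_apply, Finsupp.single_apply]
  have hR : ∀ k : κ → ℕ, MvPolynomial.coeff (Finsupp.equivFunOnFinite.symm t)
      ((Nat.multinomial univ k : MvPolynomial κ ℕ) *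
        ∏ c, ((#{a | cls a = c} : MvPolynomial κ ℕ) * MvPolynomial.X c) ^ k c) =
      if k = t then Nat.multinomial univ t * ∏ c, #{a | cls a = c} ^ t c else 0 := by
    intro k
    have : (Nat.multinomial univ k : MvPolynomial κ ℕ) *
        ∏ c, ((#{a | cls a = c} : MvPolynomial κ ℕ) * MvPolynomial.X c) ^ k c =
        MvPolynomial.monomial (Finsupp.equivFunOnFinite.symm k)
          (Nat.multinomial univ k * ∏ c, #{a | cls a = c} ^ k c) := by
      rw [MvPolynomial.monomial_eq, Finsupp.prod_fintype _ _ (by simp)]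
      simp [mul_pow, prod_mul_distrib, mul_assoc]
    rw [this, MvPolynomial.coeff_monomial]
    by_cases hk : k = t
    · simp [hk]
    · rw [if_neg hk, if_neg (by simpa using hk)]
  simp only [hL, hR] at h3
  rw [sum_boole, sum_ite_eq_of_mem' _ _ _ (mem_piAntidiag.2 ⟨ht, by simp⟩)] at h3
  exact_mod_cast h3

theorem natCast_multinomial_eq {κ : Type*} [Fintype κ] (t : κ → ℕ) :
    (Nat.multinomial univ t : ℝ) = ((∑ c, t c).factorial : ℝ) / ∏ c, ((t c).factorial : ℝ) := by
  rw [eq_div_iff (prod_ne_zero_iff.2 fun c _ => by positivity), mul_comm]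
  exact_mod_cast Nat.multinomial_spec univ t

variable {q n : ℕ} [NeZero q]

theorem card_ne_zero_eq : (#{a : Fin q | a ≠ 0} : ℝ) = (q : ℝ) - 1 := by
  rw [filter_ne', card_erase_of_mem (mem_univ _), card_univ, Fintype.card_fin,
    Nat.cast_sub (NeZero.one_le)]
  simp

theorem card_hammingNorm_eq (i : ℕ) :
    (#{x : Fin n → Fin q | hammingNorm x = i} : ℝ) = (n.choose i : ℝ) * ((q : ℝ) - 1) ^ i := by
  rcases lt_or_ge n i with h | h
  · rw [Nat.choose_eq_zero_of_lt h, filter_eq_empty_iff.2]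
    · simp
    · intro x _ hx
      have := hammingNorm_le_card_fintype (x := x)
      simp only [Fintype.card_fin] at this
      omega
  · have h1 := card_filter_class_eq (fun a : Fin q => decide (a ≠ 0)) n
      (fun b => bif b then i else n - i) (by simp; omega)
    have h2 : (univ.filter fun x : Fin n → Fin q => hammingNorm x = i) =
        univ.filter fun g : Fin n → Fin q => ∀ c : Bool,
          #{j | decide (g j ≠ 0) = c} = bif c then i else n - i := by
      ext x
      have h3 := card_filter_add_card_filter_not (s := (univ : Finset (Fin n)))
        (fun j => x j ≠ 0)
      simp only [card_univ, Fintype.card_fin] at h3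
      simp only [mem_filter, mem_univ, true_and, hammingNorm, Bool.forall_bool,
        decide_eq_true_eq, decide_eq_false_iff_not, cond_true, cond_false]
      omega
    rw [h2, h1]
    push_cast
    rw [natCast_multinomial_eq]
    simp only [Fintype.prod_bool, Fintype.sum_bool, cond_true, cond_false, decide_eq_true_eq,
      decide_eq_false_iff_not, not_not, card_ne_zero_eq]
    have h4 : #{a : Fin q | a = 0} = 1 := by simp [filter_eq']
    rw [h4, Nat.cast_choose ℝ h, Nat.add_sub_cancel' h]
    simp

theorem sphereVolume_eq_card (m : ℕ) :
    sphereVolume q n m = (#{x : Fin n → Fin q | hammingNorm x ≤ m} : ℝ) := by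
  rw [sphereVolume, card_eq_sum_card_fiberwise (f := hammingNorm) (t := Icc 0 m)
    (fun x hx => by simpa using hx)]
  push_cast
  refine sum_congr rfl fun i hi => ?_
  rw [← card_hammingNorm_eq, filter_filter]
  congr 2
  ext x
  simp only [mem_filter, mem_univ, true_and, mem_Icc] at hi ⊢
  omega

/-- The class of a pair of letters: both zero, only the first nonzero, only the second nonzero,
equal and nonzero, distinct and nonzero. -/
def pairClass (p : Fin q × Fin q) : Fin 5 :=
  if p.1 = 0 then (if p.2 = 0 then 0 else 2)
  else if p.2 = 0 then 1 else if p.1 = p.2 then 3 else 4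

/-- The number of positions at which the pair of words `(x, y)` has class `c`. -/
def pairCount (x y : Fin n → Fin q) (c : Fin 5) : ℕ := #{i | pairClass (x i, y i) = c}

theorem card_pairClass_zero : #{p : Fin q × Fin q | pairClass p = 0} = 1 := by
  rw [card_eq_one]
  refine ⟨(0, 0), ?_⟩
  ext ⟨a, b⟩
  simp only [mem_filter, mem_univ, true_and, mem_singleton, Prod.mk.injEq]
  unfold pairClass
  split_ifs <;> simp_all

theorem card_pairClass_one : (#{p : Fin q × Fin q | pairClass p = 1} : ℝ) = (q : ℝ) - 1 := by
  rw [← card_ne_zero_eq]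
  congr 1
  refine card_nbij' (fun p => p.1) (fun a => (a, 0)) ?_ ?_ ?_ (fun _ _ => rfl) <;>
  · simp only [Set.MapsTo, Set.LeftInvOn, coe_filter, Set.mem_ofPred_eq, mem_univ, true_and,
      Prod.forall]
    unfold pairClass
    intros
    split_ifs at * <;> simp_all

theorem card_pairClass_two : (#{p : Fin q × Fin q | pairClass p = 2} : ℝ) = (q : ℝ) - 1 := by
  rw [← card_ne_zero_eq]
  congr 1
  refine card_nbij' (fun p => p.2) (fun a => (0, a)) ?_ ?_ ?_ (fun _ _ => rfl) <;>
  · simp only [Set.MapsTo, Set.LeftInvOn, coe_filter, Set.mem_ofPred_eq, mem_univ, true_and,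
      Prod.forall]
    unfold pairClass
    intros
    split_ifs at * <;> simp_all

theorem card_pairClass_three : (#{p : Fin q × Fin q | pairClass p = 3} : ℝ) = (q : ℝ) - 1 := by
  rw [← card_ne_zero_eq]
  congr 1
  refine card_nbij' (fun p => p.1) (fun a => (a, a)) ?_ ?_ ?_ (fun _ _ => rfl) <;>
  · simp only [Set.MapsTo, Set.LeftInvOn, coe_filter, Set.mem_ofPred_eq, mem_univ, true_and,
      Prod.forall]
    unfold pairClass
    intros
    split_ifs at * <;> simp_all

theorem card_pairClass_four :
    (#{p : Fin q × Fin q | pairClass p = 4} : ℝ) = ((q : ℝ) - 2) * ((q : ℝ) - 1) := by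
  have : ({p : Fin q × Fin q | pairClass p = 4} : Finset _) =
      offDiag ({a : Fin q | a ≠ 0} : Finset _) := by
    ext ⟨a, b⟩
    simp only [mem_filter, mem_univ, true_and, mem_offDiag]
    unfold pairClass
    split_ifs <;> simp_all
  rw [this, offDiag_card, Nat.cast_sub (Nat.le_mul_self _), Nat.cast_mul, card_ne_zero_eq]
  ring

theorem sum_pairCount (x y : Fin n → Fin q) (P : Fin 5 → Prop) [DecidablePred P] :
    #{i | P (pairClass (x i, y i))} = ∑ c with P c, pairCount x y c := by
  rw [card_eq_sum_card_fiberwise (f := fun i => pairClass (x i, y i)) (t := univ.filter P)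
    (fun i hi => by simpa using hi)]
  refine sum_congr rfl fun c hc => ?_
  rw [pairCount, filter_filter]
  congr 1
  ext i
  simp only [mem_filter, mem_univ, true_and] at hc ⊢
  exact ⟨fun h => h.2, fun h => ⟨h ▸ hc, h⟩⟩

theorem hammingNorm_left_eq (x y : Fin n → Fin q) :
    hammingNorm x = pairCount x y 1 + pairCount x y 3 + pairCount x y 4 := by
  have := sum_pairCount x y (fun c => c = 1 ∨ c = 3 ∨ c = 4)
  rw [show (univ.filter fun c : Fin 5 => c = 1 ∨ c = 3 ∨ c = 4) = {1, 3, 4} by decide] at this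
  simp only [mem_insert, mem_singleton, sum_insert, sum_singleton, Fin.reduceEq, or_self,
    not_false_eq_true] at this
  rw [hammingNorm, add_assoc, ← this]
  congr 1
  ext i
  simp only [mem_filter, mem_univ, true_and]
  unfold pairClass
  split_ifs <;> simp_all

theorem hammingNorm_right_eq (x y : Fin n → Fin q) :
    hammingNorm y = pairCount x y 2 + pairCount x y 3 + pairCount x y 4 := by
  have := sum_pairCount x y (fun c => c = 2 ∨ c = 3 ∨ c = 4)
  rw [show (univ.filter fun c : Fin 5 => c = 2 ∨ c = 3 ∨ c = 4) = {2, 3, 4} by decide] at this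
  simp only [mem_insert, mem_singleton, sum_insert, sum_singleton, Fin.reduceEq, or_self,
    not_false_eq_true] at this
  rw [hammingNorm, add_assoc, ← this]
  congr 1
  ext i
  simp only [mem_filter, mem_univ, true_and]
  unfold pairClass
  split_ifs <;> simp_all

theorem hammingDist_eq_add (x y : Fin n → Fin q) :
    hammingDist x y = pairCount x y 1 + pairCount x y 2 + pairCount x y 4 := by
  have := sum_pairCount x y (fun c => c = 1 ∨ c = 2 ∨ c = 4)
  rw [show (univ.filter fun c : Fin 5 => c = 1 ∨ c = 2 ∨ c = 4) = {1, 2, 4} by decide] at this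
  simp only [mem_insert, mem_singleton, sum_insert, sum_singleton, Fin.reduceEq, or_self,
    not_false_eq_true] at this
  rw [hammingDist, add_assoc, ← this]
  congr 1
  ext i
  simp only [mem_filter, mem_univ, true_and]
  unfold pairClass
  split_ifs <;> simp_all [eq_comm]

theorem sum_pairCount_univ (x y : Fin n → Fin q) : ∑ c, pairCount x y c = n := by
  have := sum_pairCount x y (fun _ => True)
  simpa using this.symm

/-- The four prescribed numbers determine all five class counts, so `edgeTerm` is a multinomial
coefficient times powers of the class sizes `1`, `q - 1` (three times) and `(q - 2) * (q - 1)`. -/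
theorem card_pairCount_eq (w i j k : ℕ) (hw : j + k ≤ w) (hi : j + k ≤ i)
    (hn : w + i ≤ n + (j + k)) :
    (#{p : (Fin n → Fin q) × (Fin n → Fin q) | hammingNorm p.1 = w ∧ hammingNorm p.2 = i ∧
      pairCount p.1 p.2 3 = j ∧ pairCount p.1 p.2 4 = k} : ℝ) = edgeTerm q n w i j k := by
  set t : Fin 5 → ℕ := ![n + (j + k) - w - i, w - (j + k), i - (j + k), j, k] with ht
  have hsum : ∑ c, t c = n := by
    simp [ht, Fin.sum_univ_five]
    omega
  have h1 := card_filter_class_eq (pairClass (q := q)) n t hsum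
  have h2 : #{p : (Fin n → Fin q) × (Fin n → Fin q) | hammingNorm p.1 = w ∧
      hammingNorm p.2 = i ∧ pairCount p.1 p.2 3 = j ∧ pairCount p.1 p.2 4 = k} =
      #{g : Fin n → Fin q × Fin q | ∀ c, #{i | pairClass (g i) = c} = t c} := by
    refine card_equiv (Equiv.arrowProdEquivProdArrow _ _ _).symm ?_
    rintro ⟨x, y⟩
    have e1 := hammingNorm_left_eq x y
    have e2 := hammingNorm_right_eq x y
    have e3 := sum_pairCount_univ x y
    rw [Fin.sum_univ_five] at e3
    have e4 : ∀ c, #{i | pairClass ((Equiv.arrowProdEquivProdArrow _ _ _).symm (x, y) i) = c} =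
      pairCount x y c := fun c => rfl
    simp only [mem_filter, mem_univ, true_and, e4, Fin.forall_fin_succ, ht]
    simp only [Matrix.cons_val, Fin.succ_zero_eq_one, Fin.succ_one_eq_two, Fin.reduceSucc,
      IsEmpty.forall_iff, and_true]
    omega
  rw [h2, h1]
  push_cast
  rw [natCast_multinomial_eq, hsum, Fin.prod_univ_five, Fin.prod_univ_five,
    card_pairClass_zero, card_pairClass_one, card_pairClass_two, card_pairClass_three,
    card_pairClass_four, edgeTerm]
  simp only [ht, Matrix.cons_val]
  rw [show w + i - (j + k) = (w - (j + k)) + (i - (j + k)) + j + k by omega, pow_add, pow_add,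
    pow_add, mul_pow, Nat.cast_one, one_pow, one_mul, div_mul_eq_mul_div]
  congr 1 <;> ring

/-- The distance is `w + i - 2 * j - k`, so the `m + j` branch of the minimum encodes closeness. The
`n` branch and the upper limit hold for every actual pair of words. -/
theorem mem_Icc_lowerLimit_iff {m : ℕ} (x y : Fin n → Fin q) :
    pairCount x y 4 ∈ Icc (lowerLimit n m (hammingNorm x) (hammingNorm y) (pairCount x y 3))
      (min (hammingNorm x) (hammingNorm y) - pairCount x y 3) ↔ hammingDist x y ≤ m := by
  have e1 := hammingNorm_left_eq x y
  have e2 := hammingNorm_right_eq x y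
  have e3 := sum_pairCount_univ x y
  have e4 := hammingDist_eq_add x y
  rw [Fin.sum_univ_five] at e3
  rw [mem_Icc, lowerLimit]
  omega

theorem card_close_pairs_eq (m : ℕ) :
    (#{p : (Fin n → Fin q) × (Fin n → Fin q) | (1 ≤ hammingNorm p.1 ∧ hammingNorm p.1 ≤ m) ∧
      (1 ≤ hammingNorm p.2 ∧ hammingNorm p.2 ≤ m) ∧ hammingDist p.1 p.2 ≤ m} : ℝ) =
    ∑ w ∈ Icc 1 m, ∑ i ∈ Icc 1 m, ∑ j ∈ Icc 0 (min w i),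
      ∑ k ∈ Icc (lowerLimit n m w i j) (min w i - j), edgeTerm q n w i j k := by
  rw [card_eq_sum_card_fiberwise (f := fun p => hammingNorm p.1) (t := Icc 1 m)
    (fun x hx => by simp at hx ⊢; omega), Nat.cast_sum]
  refine sum_congr rfl fun w hw => ?_
  rw [card_eq_sum_card_fiberwise (f := fun p => hammingNorm p.2) (t := Icc 1 m)
    (fun x hx => by simp at hx ⊢; omega), Nat.cast_sum]
  refine sum_congr rfl fun i hi => ?_
  rw [card_eq_sum_card_fiberwise (f := fun p => pairCount p.1 p.2 3) (t := Icc 0 (min w i))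
    (fun p hp => by
      have e1 := hammingNorm_left_eq p.1 p.2
      have e2 := hammingNorm_right_eq p.1 p.2
      simp at hp ⊢
      omega), Nat.cast_sum]
  refine sum_congr rfl fun j hj => ?_
  rw [card_eq_sum_card_fiberwise (f := fun p => pairCount p.1 p.2 4)
    (t := Icc (lowerLimit n m w i j) (min w i - j))
    (fun p hp => by
      simp only [coe_filter, mem_filter, mem_univ, true_and, Set.mem_ofPred_eq] at hp
      obtain ⟨⟨⟨⟨_, _, h⟩, rfl⟩, rfl⟩, rfl⟩ := hp
      exact mem_coe.2 ((mem_Icc_lowerLimit_iff p.1 p.2).2 h)), Nat.cast_sum]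
  refine sum_congr rfl fun k hk => ?_
  have hk' := hk
  simp only [mem_Icc, lowerLimit] at hk' hw hi hj
  rw [← card_pairCount_eq w i j k (by omega) (by omega) (by omega)]
  congr 2
  ext p
  simp only [mem_filter, mem_univ, true_and]
  constructor
  · tauto
  · rintro ⟨rfl, rfl, rfl, rfl⟩
    have := (mem_Icc_lowerLimit_iff p.1 p.2).1 hk
    tauto

theorem card_nonzero_ball_add_one (m : ℕ) :
    (#{x : Fin n → Fin q | 1 ≤ hammingNorm x ∧ hammingNorm x ≤ m} : ℝ) + 1 =
      sphereVolume q n m := by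
  rw [sphereVolume_eq_card]
  have : ({x : Fin n → Fin q | hammingNorm x ≤ m} : Finset _) =
      insert 0 ({x : Fin n → Fin q | 1 ≤ hammingNorm x ∧ hammingNorm x ≤ m} : Finset _) := by
    ext x
    have : hammingNorm x = 0 ↔ x = 0 := hammingNorm_eq_zero
    simp only [mem_insert, mem_filter, mem_univ, true_and, ← this]
    omega
  rw [this, card_insert_of_notMem (by simp)]
  push_cast
  rfl

/-- `6 e + 1` is the number of ordered adjacent pairs in the neighbourhood of the zero word. -/
theorem six_mul_edgeQuantity_add_one (m : ℕ) :
    6 * edgeQuantity q n m + 1 =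
      (#{p : (Fin n → Fin q) × (Fin n → Fin q) | (1 ≤ hammingNorm p.1 ∧ hammingNorm p.1 ≤ m) ∧
        (1 ≤ hammingNorm p.2 ∧ hammingNorm p.2 ≤ m) ∧
        (1 ≤ hammingDist p.1 p.2 ∧ hammingDist p.1 p.2 ≤ m)} : ℝ) := by
  rw [edgeQuantity, ← card_close_pairs_eq, ← card_nonzero_ball_add_one]
  have h2 := card_filter_add_card_filter_not
    (s := ({p : (Fin n → Fin q) × (Fin n → Fin q) |
      (1 ≤ hammingNorm p.1 ∧ hammingNorm p.1 ≤ m) ∧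
      (1 ≤ hammingNorm p.2 ∧ hammingNorm p.2 ≤ m) ∧ hammingDist p.1 p.2 ≤ m} : Finset _))
    (fun p => p.1 = p.2)
  -- The pairs to discard are the diagonal ones, `V - 1` in number since zero is excluded; `6 * e`
  -- subtracts `V`, which explains the `+ 1`.
  have h3 : #{x : Fin n → Fin q | 1 ≤ hammingNorm x ∧ hammingNorm x ≤ m} =
      #(({p : (Fin n → Fin q) × (Fin n → Fin q) |
      (1 ≤ hammingNorm p.1 ∧ hammingNorm p.1 ≤ m) ∧
      (1 ≤ hammingNorm p.2 ∧ hammingNorm p.2 ≤ m) ∧ hammingDist p.1 p.2 ≤ m} : Finset _).filter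
      fun p => p.1 = p.2) := by
    refine card_nbij' (fun x => (x, x)) (fun p => p.1) ?_ ?_ ?_ ?_
    · intro x hx
      simpa using hx
    · intro p hp
      simp only [coe_filter, mem_filter, mem_univ, true_and, Set.mem_ofPred_eq] at hp ⊢
      exact hp.1.1
    · intro x _
      rfl
    · intro p hp
      simp only [coe_filter, mem_filter, mem_univ, true_and, Set.mem_ofPred_eq] at hp
      exact Prod.ext rfl hp.2
  have h4 : ({p : (Fin n → Fin q) × (Fin n → Fin q) |
        (1 ≤ hammingNorm p.1 ∧ hammingNorm p.1 ≤ m) ∧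
        (1 ≤ hammingNorm p.2 ∧ hammingNorm p.2 ≤ m) ∧
        (1 ≤ hammingDist p.1 p.2 ∧ hammingDist p.1 p.2 ≤ m)} : Finset _) =
      ({p : (Fin n → Fin q) × (Fin n → Fin q) |
      (1 ≤ hammingNorm p.1 ∧ hammingNorm p.1 ≤ m) ∧
      (1 ≤ hammingNorm p.2 ∧ hammingNorm p.2 ≤ m) ∧ hammingDist p.1 p.2 ≤ m} : Finset _).filter
      fun p => ¬ p.1 = p.2 := by
    ext p
    have : hammingDist p.1 p.2 = 0 ↔ p.1 = p.2 := hammingDist_eq_zero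
    simp only [mem_filter, mem_univ, true_and, ← this]
    omega
  rw [h4, h3, ← h2]
  push_cast
  ring

end Counting

/-! ### The graph of close words, and the numerical choices. -/

section Codes

variable {q n : ℕ}

/-- The graph on words of length `n` in which distinct words at distance at most `m` are joined. -/
def closeGraph (q n m : ℕ) : SimpleGraph (Fin n → Fin q) where
  Adj x y := 1 ≤ hammingDist x y ∧ hammingDist x y ≤ m
  symm := ⟨fun x y h => by rwa [hammingDist_comm y x]⟩
  loopless := ⟨fun x h => by simp at h⟩

instance (q n m : ℕ) : DecidableRel (closeGraph q n m).Adj := fun x y =>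
  inferInstanceAs (Decidable (1 ≤ hammingDist x y ∧ hammingDist x y ≤ m))

theorem closeGraph_adj {m : ℕ} {x y : Fin n → Fin q} :
    (closeGraph q n m).Adj x y ↔ 1 ≤ hammingDist x y ∧ hammingDist x y ≤ m := Iff.rfl

theorem card_le_maxCodeSize {d : ℕ} {C : Finset (Fin n → Fin q)} (hC : IsCode q n d C) :
    #C ≤ maxCodeSize q n d := by
  classical
  exact le_sup (f := Finset.card) (mem_filter.2 ⟨mem_univ _, hC⟩)

theorem isCode_of_indep {d : ℕ} {C : Finset (Fin n → Fin q)}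
    (hC : ∀ u ∈ C, ∀ v ∈ C, ¬ (closeGraph q n (d - 1)).Adj u v) : IsCode q n d C := by
  intro u hu v hv huv
  have h1 := hC u hu v hv
  have h2 := hammingDist_pos.2 huv
  rw [closeGraph_adj] at h1
  omega

variable [NeZero q]

theorem hammingNorm_sub_eq (x v : Fin n → Fin q) : hammingNorm (x - v) = hammingDist v x := by
  rw [hammingDist_eq_hammingNorm, neg_add_eq_sub]

theorem card_dist_filter_eq (P : ℕ → Prop) [DecidablePred P] (v : Fin n → Fin q) :
    #{x : Fin n → Fin q | P (hammingDist v x)} = #{x : Fin n → Fin q | P (hammingNorm x)} := by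
  refine card_equiv (Equiv.subRight v) fun x => ?_
  simp [hammingNorm_sub_eq]

theorem closeGraph_isRegular (m : ℕ) : (closeGraph q n m).IsRegularOfDegree
    #{x : Fin n → Fin q | 1 ≤ hammingNorm x ∧ hammingNorm x ≤ m} := by
  intro v
  rw [← card_dist_filter_eq (fun k => 1 ≤ k ∧ k ≤ m) v, ← SimpleGraph.card_neighborFinset_eq_degree]
  congr 1
  ext x
  simp [closeGraph_adj]

/-- Translation by `-v` carries adjacent pairs in `H` injectively to adjacent pairs of neighbours of
the zero word. -/
theorem sum_card_adj_le {m : ℕ} {v : Fin n → Fin q} {H : Finset (Fin n → Fin q)}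
    (hH : H ⊆ (closeGraph q n m).neighborFinset v) :
    ∑ u ∈ H, #{w ∈ H | (closeGraph q n m).Adj u w} ≤
      #{p : (Fin n → Fin q) × (Fin n → Fin q) | (1 ≤ hammingNorm p.1 ∧ hammingNorm p.1 ≤ m) ∧
        (1 ≤ hammingNorm p.2 ∧ hammingNorm p.2 ≤ m) ∧
        (1 ≤ hammingDist p.1 p.2 ∧ hammingDist p.1 p.2 ≤ m)} := by
  rw [← card_sigma]
  have hadj : ∀ u ∈ H, 1 ≤ hammingNorm (u - v) ∧ hammingNorm (u - v) ≤ m := fun u hu => by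
    rw [hammingNorm_sub_eq, ← closeGraph_adj, ← SimpleGraph.mem_neighborFinset]
    exact hH hu
  refine card_le_card_of_injOn (fun s => (s.1 - v, s.2 - v)) ?_ ?_
  · rintro ⟨u, w⟩ h
    simp only [coe_sigma, Set.mem_sigma_iff, mem_coe, mem_filter] at h
    simp only [mem_coe, mem_filter, mem_univ, true_and]
    refine ⟨hadj u h.1, hadj w h.2.1, ?_⟩
    rw [hammingDist_eq_hammingNorm, neg_add_eq_sub, sub_sub_sub_cancel_right, hammingNorm_sub_eq]
    exact h.2.2
  · rintro ⟨u, w⟩ _ ⟨u', w'⟩ _ h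
    simp only [Prod.mk.injEq, sub_left_inj] at h
    obtain ⟨rfl, rfl⟩ := h
    rfl

/-- The Gilbert–Varshamov bound. -/
theorem pow_le_maxCodeSize_mul_sphereVolume {d : ℕ} (hd : 1 ≤ d) :
    (q : ℝ) ^ n ≤ maxCodeSize q n d * sphereVolume q n (d - 1) := by
  classical
  obtain ⟨C, hC, hmax⟩ := exists_mem_eq_sup
    ((univ : Finset (Finset (Fin n → Fin q))).filter (IsCode q n d))
    ⟨∅, by simp [IsCode]⟩ Finset.card
  have hCcode : IsCode q n d C := (mem_filter.1 hC).2
  have hsize : maxCodeSize q n d = #C := by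
    rw [← hmax, maxCodeSize]
  -- A word outside all these balls could be added to a code of maximum size.
  have hcover : (univ : Finset (Fin n → Fin q)) ⊆
      C.biUnion fun c => {x | hammingDist c x ≤ d - 1} := by
    intro w _
    by_contra hw
    simp only [mem_biUnion, mem_filter, mem_univ, true_and, not_exists, not_and, not_le] at hw
    have hwC : w ∉ C := fun h => by simpa using hw w h
    have hcode : IsCode q n d (insert w C) := by
      intro u hu v hv huv
      rcases mem_insert.1 hu with rfl | hu' <;> rcases mem_insert.1 hv with rfl | hv'
      · exact absurd rfl huv
      · have := hw v hv'
        rw [hammingDist_comm] at this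
        omega
      · have := hw u hu'
        omega
      · exact hCcode u hu' v hv' huv
    have := card_le_maxCodeSize hcode
    rw [card_insert_of_notMem hwC, hsize] at this
    omega
  have h1 := (card_le_card hcover).trans (card_biUnion_le_card_mul _ _
    #{x : Fin n → Fin q | hammingNorm x ≤ d - 1}
    fun c _ => (card_dist_filter_eq (fun k => k ≤ d - 1) c).le)
  rw [card_univ, Fintype.card_fun, Fintype.card_fin, Fintype.card_fin, ← hsize] at h1
  rw [sphereVolume_eq_card]
  exact_mod_cast h1

/-- The numerical estimates behind the choice of the fugacity `1 / (2 √p)` and the threshold `r`. -/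
theorem fugacity_estimates {V E p r : ℝ} (hE : 0 < E) (hp : p = 6 * E + 1) (hp2 : 2 ≤ p)
    (hr : 32 ≤ r) (hV : V = r ^ 2 * √E) :
    2 * Real.log r / (5 * Real.log 2) * (1 / (2 * √p) + r) ≤ (V - 1) * (1 / (2 * √p)) ∧
      2 * Real.log r / (5 * Real.log 2) * (1 + 1 / (2 * √p)) ≤
        Real.log r - (1 / (2 * √p)) ^ 2 * p := by
  have hlog2 := Real.log_two_gt_d9
  have hlog2' := Real.log_two_lt_d9
  have hsp : 1 ≤ √p := Real.one_le_sqrt.2 (by linarith)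
  have hsq : √p ^ 2 = p := Real.sq_sqrt (by linarith)
  set x := 1 / (2 * √p) with hx
  have hx0 : 0 < x := by positivity
  have hx1 : x ≤ 1 / 2 := by
    rw [hx, div_le_div_iff₀ (by positivity) two_pos]
    linarith
  have hxp : x ^ 2 * p = 1 / 4 := by
    rw [hx, div_pow, mul_pow, hsq]
    field_simp
    norm_num
  have hlog32 : Real.log 32 = 5 * Real.log 2 := by
    rw [show (32 : ℝ) = 2 ^ 5 by norm_num, Real.log_pow]
    norm_num
  have hL : 5 * Real.log 2 ≤ Real.log r := hlog32 ▸ Real.log_le_log (by norm_num) hr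
  have hL' : Real.log r ≤ 5 * Real.log 2 + r / 32 - 1 := by
    have := Real.log_le_sub_one_of_pos (x := r / 32) (by positivity)
    rw [Real.log_div (by positivity) (by norm_num), hlog32] at this
    linarith
  -- `2 / (5 * log 2)` is about `0.57708`.
  have hb : 2 * Real.log r / (5 * Real.log 2) ≤ 0.5772 * Real.log r := by
    rw [div_le_iff₀ (by positivity)]
    nlinarith
  -- From `p ≥ 2` comes `6 * E ≥ 1`, so `p ≤ 12 * E`; and `1 / (2 * √12)` is about `0.1443`.
  have hxE : 0.144 ≤ x * √E := by
    have h1 : √p ≤ √12 * √E := by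
      rw [← Real.sqrt_mul (by norm_num)]
      exact Real.sqrt_le_sqrt (by linarith)
    have h2 : √12 ≤ 3.4642 := Real.sqrt_le_iff.2 (by norm_num)
    have h3 : √p ≤ 3.4642 * √E := h1.trans (by gcongr)
    rw [hx, div_mul_eq_mul_div, le_div_iff₀ (by positivity)]
    linarith
  constructor
  · have h1 : 0.144 * r ^ 2 - 1 / 2 ≤ (V - 1) * x := by
      have := mul_le_mul_of_nonneg_left hxE (sq_nonneg r)
      rw [hV]
      linarith
    have h2 : 2 * Real.log r / (5 * Real.log 2) ≤ 0.5772 * (2.466 + r / 32) := by linarith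
    calc _ ≤ 0.5772 * (2.466 + r / 32) * (1 / 2 + r) := by gcongr
      _ ≤ 0.144 * r ^ 2 - 1 / 2 := by nlinarith
      _ ≤ _ := h1
  · rw [hxp]
    calc _ ≤ 0.5772 * Real.log r * (1 + 1 / 2) := by
          refine mul_le_mul hb (by linarith) (by positivity) ?_
          linarith
      _ ≤ _ := by linarith

end Codes

theorem mainTheorem6 (q n d : ℕ) (hq : 2 ≤ q) (hd : 1 ≤ d) (hdn : d ≤ n)
    (he : 0 < edgeQuantity q n (d - 1)) :
    (maxCodeSize q n d : ℝ) ≥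
      ((q : ℝ) ^ n / sphereVolume q n (d - 1)) *
        ((Real.logb 2 (sphereVolume q n (d - 1)) -
          Real.logb 2 (Real.sqrt (edgeQuantity q n (d - 1)))) / 10) := by
  have : NeZero q := ⟨by omega⟩
  have hlog2 : 0 < Real.log 2 := Real.log_pos one_lt_two
  have hdeg := card_nonzero_ball_add_one (q := q) (n := n) (d - 1)
  have hGV := pow_le_maxCodeSize_mul_sphereVolume (q := q) (n := n) hd
  have hP := six_mul_edgeQuantity_add_one (q := q) (n := n) (d - 1)
  have hVpos : 0 < sphereVolume q n (d - 1) := hdeg ▸ by positivity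
  set V := sphereVolume q n (d - 1)
  set E := edgeQuantity q n (d - 1)
  rw [ge_iff_le, div_mul_eq_mul_div, div_le_iff₀ hVpos]
  -- A logarithmic factor of at most `1` is covered by Gilbert–Varshamov; a larger one forces `r ≥ 2
  -- ^ 5`.
  rcases le_or_gt ((Real.logb 2 V - Real.logb 2 (√E)) / 10) 1 with hle | hgt
  · refine le_trans ?_ hGV
    exact mul_le_of_le_one_right (by positivity) hle
  · have hsE : 0 < √E := Real.sqrt_pos.2 he
    set r := √(V / √E) with hr
    have hr2 : r ^ 2 = V / √E := Real.sq_sqrt (by positivity)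
    have hr0 : 0 < r := Real.sqrt_pos.2 (by positivity)
    have hlogr : Real.logb 2 V - Real.logb 2 (√E) = 2 * Real.log r / Real.log 2 := by
      rw [← Real.logb_div hVpos.ne' hsE.ne', ← hr2, Real.logb, Real.log_pow]
      norm_num
    rw [hlogr] at hgt ⊢
    have hr32 : 32 ≤ r := by
      rw [lt_div_iff₀ (by norm_num), one_mul, lt_div_iff₀ hlog2] at hgt
      refine (Real.log_le_log_iff (by norm_num) hr0).1 ?_
      rw [show (32 : ℝ) = 2 ^ 5 by norm_num, Real.log_pow]
      push_cast
      linarith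
    -- `6 * E + 1` is a cardinality exceeding `1`, hence at least `2`.
    have hp2 : 2 ≤ 6 * E + 1 := by
      have h1 : 1 < 6 * E + 1 := by linarith
      rw [hP] at h1 ⊢
      exact_mod_cast h1
    obtain ⟨h1, h2⟩ := fugacity_estimates (V := V) he rfl hp2 hr32 (by rw [hr2]; field_simp)
    have hlogr0 : 0 ≤ Real.log r := Real.log_nonneg (by linarith)
    obtain ⟨I, hI, hcard⟩ := exists_indep_of_local_occupancy
      (x := 1 / (2 * √(6 * E + 1))) (b := 2 * Real.log r / (5 * Real.log 2))
      (by positivity) (closeGraph_isRegular (q := q) (n := n) (d - 1)) fun v H hH =>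
        local_occupancy (by positivity) (by positivity) (by linarith) H
          (by rw [hP]; exact_mod_cast sum_card_adj_le hH) (by rw [← hdeg] at h1; simpa using h1) h2
    have hcode : (#I : ℝ) ≤ maxCodeSize q n d := by
      exact_mod_cast card_le_maxCodeSize (isCode_of_indep hI)
    rw [Fintype.card_fun, Fintype.card_fin, Fintype.card_fin, Nat.cast_pow] at hcard
    calc (q : ℝ) ^ n * (2 * Real.log r / Real.log 2 / 10)
        = 2 * Real.log r / (5 * Real.log 2) * (q : ℝ) ^ n / 2 := by ring
      -- `hcard` has the degree `V - 1` here, which is relaxed to `V`.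
      _ ≤ #I * V := by
        have : (0 : ℝ) ≤ #I := by positivity
        nlinarith
      _ ≤ _ := by gcongr
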